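/- **Lemma.** Let $x_1,\dots,x_n\in\mathbb R^d$ ($n,d\ge1$) be the users' vectors, $\mu=\frac1n\sum_i x_i$, and let $c,\varepsilon>0$. The *project-and-perturb* mechanism with parameters $t,w\ge 1$, $m=tw$ and $\sigma\ge0$ is the following. 1. Draw a sparse random projection $S\in\mathbb R^{m\times d}$, $$S=\frac1{\sqrt t}\begin{bmatrix}S_1\\ \vdots\\ S_t\end{bmatrix},\qquad (S_i)_{k,j}=\sigma_i(j)\,\mathbf 1\{h_i(j)=k\},\quad k\in[w],\ j\in[d],$$ where all $h_i(j)$ (uniform on $[w]$) and all $\sigma_i(j)$ (uniform on $\{-1,+1\}$) are independent. 2. User $i$ sends $y_i=\mathsf{clip}_{\ell_2,1.1c}(Sx_i)$, where $\mathsf{clip}_{\ell_2,r}(y)=\min\{1,r/\|y\|_2\}\,y$. 3. Output $\hat\mu=S^{\mathsf T}\bigl(\frac1n\sum_i y_i+N\bigr)$, where $N\sim\mathcal N(0,\sigma^2 I_m)$ is independent of $S$. $(\varepsilon,\delta)$-DP means $\Pr(\hat\mu(D)\in A)\le e^{\varepsilon}\Pr(\hat\mu(D')\in A)+\delta$ for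 all measurable $A$ and all datasets $D,D'$ that differ in the record of one user, which may be added, removed or replaced; the number $n$ is public, it is fixed, and an absent user contributes $0$ to the sum. Then the following hold. (a) *Privacy.* For all $\delta>0$ and $\varepsilon_0>0$ there is $\kappa>0$, depending only on $\delta$ and $\varepsilon_0$, such that for all $n,d,t,w\ge1$, $c>0$ and $0<\varepsilon\le\varepsilon_0$ the mechanism is $(\varepsilon,\delta)$-DP whenever $\sigma^2\ge\kappa\,\frac{c^2}{n^2\varepsilon^2}$. (b) *Utility.* For all constants $\kappa_1,\kappa_2,a_1,a_2,b_1,b_2>0$ there is $C>0$, depending only on them, such that, whenever $$\kappa_1\tfrac{c^2}{n^2\varepsilon^2}\le\sigma^2\le\kappa_2\tfrac{c^2}{n^2\varepsilon^2},\qquad a_1n^2\varepsilon^2\le m\le a_2n^2\varepsilon^2,\qquad b_1\bigl(\log d+\log(n^2\varepsilon^2)\bigr)\le t\le b_2\bigl(\log d+\log(n^2\varepsilon^2)\bigr),$$ all $x_1,\dots,x_n$ with $\|x_i\|_2\le c$ satisfy $$\mathbb E\,\|\hat\mu-\mu\|_2^2\le C\,\frac{c^2d}{n^2\varepsilon^2}.$$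 (c) *Dimension reduction.* There are constants $a_1,a_2,b_1,b_2>0$ such that for all $\delta,\varepsilon_0>0$ there are $\kappa,C>0$ for which the following holds. For all $n\ge1$, $d\ge2$, $c>0$ and $0<\varepsilon\le\varepsilon_0$ with $n^2\varepsilon^2\ge1$ and $n^2\varepsilon^2\ge\log d$, there are $t,w\ge1$ such that $m=tw$ and $t$ satisfy the bounds of (b), and the mechanism with $\sigma^2=\kappa\frac{c^2}{n^2\varepsilon^2}$ is $(\varepsilon,\delta)$-DP and has $\mathbb E\|\hat\mu-\mu\|_2^2\le C\frac{c^2d}{n^2\varepsilon^2}$ for all $x_1,\dots,x_n$ with $\|x_i\|_2\le c$. So the dimension can be reduced to $m=O(n^2\varepsilon^2)$ with the error of the order $O_\delta\bigl(\frac{c^2d}{n^2\varepsilon^2}\bigr)$ of the Gaussian mechanism without projection. -/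

import Mathlib

open MeasureTheory ProbabilityTheory

noncomputable section

/-- The randomness of `t` count-sketches of `[d]` into `[w]`: for each block `i : Fin t` and each
coordinate `j : Fin d`, the bucket `h_i(j)` and the sign bit of `σ_i(j)`. -/
abbrev SketchSeed (t d w : ℕ) : Type := Fin t → Fin d → Fin w × Bool

/-- All hash values `h_i(j)` (uniform on `[w]`) and all signs `σ_i(j)` (uniform on `{-1, +1}`)
are mutually independent. -/
def sketchLaw (t d w : ℕ) : Measure (SketchSeed t d w) :=
  Measure.pi fun _ => Measure.pi fun _ =>
    (uniformOn (Set.univ : Set (Fin w))).prod (uniformOn (Set.univ : Set Bool))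

/-- The sign `±1` encoded by a bit. -/
def signOf (b : Bool) : ℝ := if b then 1 else -1

/-- The sparse random projection `S ∈ ℝ^{m × d}`, `m = t * w`: the `t` count-sketch blocks stacked
on top of each other and scaled by `1 / √t`. The rows are indexed by pairs (block, bucket). -/
def sketchMatrix {t d w : ℕ} (s : SketchSeed t d w) : Matrix (Fin t × Fin w) (Fin d) ℝ :=
  Matrix.of fun r j =>
    (1 / Real.sqrt t) * (if (s r.1 j).1 = r.2 then signOf (s r.1 j).2 else 0)

/-- `ℓ₂`-clipping: the radial projection onto the closed ball of radius `r`. -/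
def l2clip {ι : Type*} [Fintype ι] (r : ℝ) (y : EuclideanSpace ℝ ι) : EuclideanSpace ℝ ι :=
  min 1 (r / ‖y‖) • y

/-- A dataset with slots for `n` users, at most one vector of `ℝ^d` per user;
`none` means that the user's record is absent. -/
abbrev UserData (n d : ℕ) : Type := Fin n → Option (EuclideanSpace ℝ (Fin d))

/-- User-level neighbours: the two datasets agree outside the record of one user, which may be
added, removed, or replaced by another one. -/
def UserNeighbor {n d : ℕ} (D D' : UserData n d) : Prop :=
  ∃ i, ∀ j, j ≠ i → D j = D' j

/-- The message `clip_{1.1 c}(S x)` of a user with record `x`; an absent user sends nothing. -/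
def userMessage {t d w : ℕ} (c : ℝ) (s : SketchSeed t d w) :
    Option (EuclideanSpace ℝ (Fin d)) → EuclideanSpace ℝ (Fin t × Fin w)
  | none => 0
  | some x => l2clip (1.1 * c) ((sketchMatrix s).toEuclideanLin x)

/-- The output `Sᵀ ((1/n) ∑ᵢ yᵢ + σ g)`, for given randomness `s` of the sketch and `g` of the
noise. -/
def estimate {n t d w : ℕ} (c σ : ℝ) (D : UserData n d)
    (ω : SketchSeed t d w × EuclideanSpace ℝ (Fin t × Fin w)) : EuclideanSpace ℝ (Fin d) :=
  (sketchMatrix ω.1).transpose.toEuclideanLin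
    ((1 / (n : ℝ)) • ∑ i, userMessage c ω.1 (D i) + σ • ω.2)

/-- The law of the output of the project-and-perturb mechanism: the sketch is drawn from
`sketchLaw`, and, independently, `g` is a standard Gaussian vector in `ℝ^m`, `m = t * w`
(so that `σ g ∼ N(0, σ² I_m)`). -/
def projectAndPerturb {n d : ℕ} (t w : ℕ) (c σ : ℝ) (D : UserData n d) :
    Measure (EuclideanSpace ℝ (Fin d)) :=
  ((sketchLaw t d w).prod (stdGaussian (EuclideanSpace ℝ (Fin t × Fin w)))).map (estimate c σ D)

/-- `(ε, δ)`-differential privacy of a randomized mechanism, given by its output laws. -/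
def IsDP {𝓓 Ω : Type*} [MeasurableSpace Ω] (Neighbor : 𝓓 → 𝓓 → Prop) (M : 𝓓 → Measure Ω)
    (ε δ : ℝ) : Prop :=
  ∀ D D', Neighbor D D' → ∀ A, MeasurableSet A →
    M D A ≤ ENNReal.ofReal (Real.exp ε) * M D' A + ENNReal.ofReal δ

/-- The mean squared error of an estimator with law `P` of the vector `μ` is finite and at
most `B`. -/
def MSEAtMost {d : ℕ} (P : Measure (EuclideanSpace ℝ (Fin d))) (μ : EuclideanSpace ℝ (Fin d))
    (B : ℝ) : Prop :=
  Integrable (fun z => ‖z - μ‖ ^ 2) P ∧ ∫ z, ‖z - μ‖ ^ 2 ∂P ≤ B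

/-- The mean `(1/n) ∑ᵢ xᵢ`. -/
def sampleMean {n d : ℕ} (x : Fin n → EuclideanSpace ℝ (Fin d)) : EuclideanSpace ℝ (Fin d) :=
  (1 / (n : ℝ)) • ∑ i, x i

/-- `f` lies between `a * g` and `b * g`: the bounds behind `f = Θ(g)`. -/
def Between (a b g f : ℝ) : Prop := a * g ≤ f ∧ f ≤ b * g

end

/-! Privacy. For a fixed sketch `S`, the output is `Sᵀ` applied to a Gaussian mechanism. Clipping
bounds its sensitivity by `2.2 c / n`, whatever `S` does to the data. By Cameron–Martin
(`stdGaussian_map_add`), a shift by `v` has density `exp(⟨v, x⟩ - ‖v‖² / 2)`, which exceeds `e^ε`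
only on an event that Chebyshev's inequality makes rarer than `δ`; this tail bound is enough because
`κ` may depend on `δ` in any way. Averaging over `S`, which is independent of the noise, preserves
the inequality.

Utility. The noise costs `σ² E‖Sᵀ g‖² = σ² d`, since the columns of `S` are unit vectors. The rest
of the error comes from `SᵀS x - x`. Its `j`-th coordinate is a sum of signed collisions of `j` with
the other coordinates; these are pairwise orthogonal with second moment `1 / w`, hence `E‖SᵀS x -
x‖² ≤ d ‖x‖² / m`. Clipping needs no high-probability event: it acts only if `‖S x‖ > 1.1 c`, and
then `‖SᵀS x - x‖` is already of order `c`, so clipping worsens the error by at most a constant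
factor (`norm_transpose_l2clip_sub_le`). With `m` of order `n² ε²`, both contributions are of order
`c² d / (n² ε²)`. -/

/-! ### Gaussian measures: translations and linear functionals -/

/-- Exponential tilting of the standard Gaussian measure on `ℝ` is a translation. -/
theorem gaussianReal_one_withDensity (v : ℝ) :
    (gaussianReal 0 1).withDensity (fun x => ENNReal.ofReal (Real.exp (v * x - v ^ 2 / 2))) =
      gaussianReal v 1 := by
  rw [gaussianReal_of_var_ne_zero 0 one_ne_zero, gaussianReal_of_var_ne_zero v one_ne_zero,
    ← withDensity_mul _ (measurable_gaussianPDF 0 1) (by fun_prop)]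
  congr 1
  ext x
  simp only [Pi.mul_apply, gaussianPDF_def, gaussianPDFReal_def]
  rw [← ENNReal.ofReal_mul (by positivity), mul_assoc, ← Real.exp_add]
  congr 3
  simp only [NNReal.coe_one]
  ring

/-- Exponential tilting of the product of standard Gaussian measures is a translation. -/
theorem pi_gaussianReal_map_add {ι : Type*} [Fintype ι] (v : ι → ℝ) :
    (Measure.pi fun _ : ι => gaussianReal 0 1).map (· + v) =
      (Measure.pi fun _ : ι => gaussianReal 0 1).withDensity
        (fun x => ENNReal.ofReal (∏ i, Real.exp (v i * x i - v i ^ 2 / 2))) := by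
  have hmap : (Measure.pi fun _ : ι => gaussianReal 0 1).map (· + v) =
      Measure.pi fun i => gaussianReal (v i) 1 := by
    have := Measure.pi_map_pi (μ := fun _ : ι => gaussianReal 0 1) (f := fun i x => x + v i)
      (fun i => by fun_prop)
    simp_rw [gaussianReal_map_add_const, zero_add] at this
    exact this
  rw [hmap]
  refine Measure.pi_eq fun s hs => ?_
  -- Integrability allows the passage to Bochner integrals below, where the integral of a product
  -- over a box factorizes.
  have hfin (i : ι) : Integrable (fun x => Real.exp (v i * x - v i ^ 2 / 2))
      ((gaussianReal 0 1).restrict (s i)) := by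
    refine ⟨by fun_prop, ?_⟩
    rw [hasFiniteIntegral_iff_ofReal (ae_of_all _ fun _ => (Real.exp_pos _).le),
      ← withDensity_apply _ (hs i), gaussianReal_one_withDensity]
    exact measure_lt_top _ _
  rw [withDensity_apply _ (MeasurableSet.univ_pi hs), Measure.restrict_pi_pi,
    ← ofReal_integral_eq_lintegral_ofReal (Integrable.fintype_prod hfin)
      (ae_of_all _ fun _ => Finset.prod_nonneg fun _ _ => (Real.exp_pos _).le),
    integral_fintype_prod_eq_prod (fun i x => Real.exp (v i * x - v i ^ 2 / 2)),
    ENNReal.ofReal_prod_of_nonneg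
      (fun _ _ => integral_nonneg fun _ => (Real.exp_pos _).le)]
  refine Finset.prod_congr rfl fun i _ => ?_
  rw [ofReal_integral_eq_lintegral_ofReal (hfin i) (ae_of_all _ fun _ => (Real.exp_pos _).le),
    ← withDensity_apply _ (hs i), gaussianReal_one_withDensity]

/-- Cameron–Martin formula for the standard Gaussian measure. -/
theorem stdGaussian_map_add {ι : Type*} [Fintype ι] (v : EuclideanSpace ℝ ι) :
    (stdGaussian (EuclideanSpace ℝ ι)).map (· + v) =
      (stdGaussian (EuclideanSpace ℝ ι)).withDensity
        (fun x => ENNReal.ofReal (Real.exp (inner ℝ v x - ‖v‖ ^ 2 / 2))) := by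
  have hm : Measurable (WithLp.toLp 2 : (ι → ℝ) → EuclideanSpace ℝ ι) := by fun_prop
  have hcomp : (fun x : ι → ℝ => WithLp.toLp 2 x + v) =
      WithLp.toLp 2 ∘ (· + WithLp.ofLp v) := rfl
  ext s hs
  rw [withDensity_apply _ hs, ← map_pi_eq_stdGaussian, Measure.map_map (by fun_prop) hm,
    setLIntegral_map hs (by fun_prop) hm]
  change Measure.map (fun x : ι → ℝ => WithLp.toLp 2 x + v) _ s = _
  rw [hcomp, ← Measure.map_map hm (by fun_prop), Measure.map_apply hm hs,
    pi_gaussianReal_map_add, withDensity_apply _ (hm hs)]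
  congr 1
  ext x
  rw [← Real.exp_sum, EuclideanSpace.real_norm_sq_eq, PiLp.inner_apply,
    Finset.sum_sub_distrib, Finset.sum_div]
  simp [mul_comm]

theorem variance_inner_stdGaussian {E : Type*} [NormedAddCommGroup E] [InnerProductSpace ℝ E]
    [FiniteDimensional ℝ E] [MeasurableSpace E] [BorelSpace E] (v : E) :
    Var[fun x => inner ℝ v x; stdGaussian E] = ‖v‖ ^ 2 := by
  simpa using variance_dual_stdGaussian (innerSL ℝ v)

theorem integral_inner_stdGaussian {E : Type*} [NormedAddCommGroup E] [InnerProductSpace ℝ E]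
    [FiniteDimensional ℝ E] [MeasurableSpace E] [BorelSpace E] (v : E) :
    ∫ x, inner ℝ v x ∂stdGaussian E = 0 := by
  simpa using integral_strongDual_stdGaussian (innerSL ℝ v)

theorem memLp_inner_stdGaussian {E : Type*} [NormedAddCommGroup E] [InnerProductSpace ℝ E]
    [FiniteDimensional ℝ E] [MeasurableSpace E] [BorelSpace E] (v : E) :
    MemLp (fun x => inner ℝ v x) 2 (stdGaussian E) := by
  simpa using IsGaussian.memLp_dual (stdGaussian E) (innerSL ℝ v) 2 (by simp)

theorem lintegral_inner_sq_stdGaussian {E : Type*} [NormedAddCommGroup E] [InnerProductSpace ℝ E]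
    [FiniteDimensional ℝ E] [MeasurableSpace E] [BorelSpace E] (v : E) :
    ∫⁻ x, ENNReal.ofReal (inner ℝ v x ^ 2) ∂stdGaussian E = ENNReal.ofReal (‖v‖ ^ 2) := by
  rw [← variance_inner_stdGaussian v, ofReal_variance (memLp_inner_stdGaussian v),
    evariance_eq_lintegral_ofReal, integral_inner_stdGaussian]
  simp

/-- The Gaussian mechanism with unit noise is `(ε, δ)`-private for small shifts. -/
theorem stdGaussian_shift_le {ι : Type*} [Fintype ι] {ε δ : ℝ} (hε : 0 < ε)
    {v : EuclideanSpace ℝ ι} (hv : ‖v‖ ^ 2 ≤ ε) (hvδ : 4 * ‖v‖ ^ 2 ≤ δ * ε ^ 2)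
    {B : Set (EuclideanSpace ℝ ι)} (hB : MeasurableSet B) :
    stdGaussian (EuclideanSpace ℝ ι) ((· + v) ⁻¹' B) ≤
      ENNReal.ofReal (Real.exp ε) * stdGaussian (EuclideanSpace ℝ ι) B + ENNReal.ofReal δ := by
  set γ := stdGaussian (EuclideanSpace ℝ ι)
  -- The points at which the density of the shifted law is at most `e^ε`.
  set T : Set (EuclideanSpace ℝ ι) := {x | inner ℝ v x - ‖v‖ ^ 2 / 2 ≤ ε}
  have hT : MeasurableSet T := measurableSet_le (by fun_prop) measurable_const
  have hshift : Measurable (fun x : EuclideanSpace ℝ ι => x + v) := by fun_prop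
  have hmain : γ ((· + v) ⁻¹' (B ∩ T)) ≤ ENNReal.ofReal (Real.exp ε) * γ B := by
    rw [← Measure.map_apply hshift (hB.inter hT), stdGaussian_map_add,
      withDensity_apply _ (hB.inter hT)]
    calc ∫⁻ x in B ∩ T, ENNReal.ofReal (Real.exp (inner ℝ v x - ‖v‖ ^ 2 / 2)) ∂γ
        ≤ ∫⁻ _ in B ∩ T, ENNReal.ofReal (Real.exp ε) ∂γ :=
          setLIntegral_mono measurable_const fun x hx =>
            ENNReal.ofReal_le_ofReal (Real.exp_le_exp.2 hx.2)
      _ = ENNReal.ofReal (Real.exp ε) * γ (B ∩ T) := setLIntegral_const _ _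
      _ ≤ _ := by gcongr; exact Set.inter_subset_left
  have htail : γ ((· + v) ⁻¹' Tᶜ) ≤ ENNReal.ofReal δ := by
    -- If `x + v ∉ T`, then `⟨v, x⟩ > ε - ‖v‖² / 2 ≥ ε / 2`. Chebyshev at `ε / 2` bounds the
    -- probability by `4 ‖v‖² / ε² ≤ δ`.
    have hcheb := meas_ge_le_variance_div_sq (memLp_inner_stdGaussian v) (half_pos hε)
    rw [integral_inner_stdGaussian, variance_inner_stdGaussian] at hcheb
    refine (measure_mono fun x hx => ?_).trans (hcheb.trans (ENNReal.ofReal_le_ofReal ?_))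
    · simp only [T, Set.mem_preimage, Set.mem_compl_iff, Set.mem_ofPred_eq, not_le, inner_add_right,
        real_inner_self_eq_norm_sq] at hx
      simp only [Set.mem_ofPred_eq, sub_zero]
      exact le_trans (by linarith) (le_abs_self _)
    · rw [div_le_iff₀ (by positivity)]
      linarith
  calc γ ((· + v) ⁻¹' B) ≤ γ ((· + v) ⁻¹' (B ∩ T) ∪ (· + v) ⁻¹' Tᶜ) :=
        measure_mono fun x hx => by by_cases h : x + v ∈ T <;> simp_all
    _ ≤ _ := (measure_union_le _ _).trans (add_le_add hmain htail)

/-! ### Symmetries of the sketch and second moments of collisions -/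

theorem measurePreserving_uniformOn_univ {Ω : Type*} [Fintype Ω] [MeasurableSpace Ω]
    [MeasurableSingletonClass Ω] (e : Ω ≃ Ω) :
    MeasurePreserving e (uniformOn Set.univ) (uniformOn Set.univ) := by
  refine ⟨Measurable.of_discrete, Measure.ext fun s _ => ?_⟩
  rw [Measure.map_apply Measurable.of_discrete (Set.Finite.measurableSet (Set.toFinite s)),
    uniformOn_univ, uniformOn_univ, Measure.count_apply (Set.Finite.measurableSet (Set.toFinite _)),
    Measure.count_apply (Set.Finite.measurableSet (Set.toFinite _)),
    Set.encard_preimage_of_bijective e.bijective]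

instance {t d w : ℕ} [NeZero w] : IsProbabilityMeasure (sketchLaw t d w) := by
  have : IsProbabilityMeasure (uniformOn (Set.univ : Set (Fin w))) :=
    isProbabilityMeasure_uniformOn Set.finite_univ Set.univ_nonempty
  have : IsProbabilityMeasure (uniformOn (Set.univ : Set Bool)) :=
    isProbabilityMeasure_uniformOn Set.finite_univ Set.univ_nonempty
  unfold sketchLaw
  infer_instance

/-- Apply a bucket permutation and a sign permutation to a single entry of the seed. -/
def SketchSeed.modify {t d w : ℕ} (i : Fin t) (j : Fin d) (e : Fin w ≃ Fin w) (f : Bool ≃ Bool)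
    (s : SketchSeed t d w) : SketchSeed t d w := fun i' j' =>
  (if i' = i ∧ j' = j then Prod.map e f else Prod.map (Equiv.refl _) (Equiv.refl _)) (s i' j')

theorem measurePreserving_modify {t d w : ℕ} [NeZero w] (i : Fin t) (j : Fin d)
    (e : Fin w ≃ Fin w) (f : Bool ≃ Bool) :
    MeasurePreserving (SketchSeed.modify i j e f) (sketchLaw t d w) (sketchLaw t d w) := by
  have : IsProbabilityMeasure (uniformOn (Set.univ : Set (Fin w))) :=
    isProbabilityMeasure_uniformOn Set.finite_univ Set.univ_nonempty
  have : IsProbabilityMeasure (uniformOn (Set.univ : Set Bool)) :=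
    isProbabilityMeasure_uniformOn Set.finite_univ Set.univ_nonempty
  refine measurePreserving_pi _ _ fun i' => measurePreserving_pi _ _ fun j' => ?_
  split_ifs
  · exact (measurePreserving_uniformOn_univ e).prod (measurePreserving_uniformOn_univ f)
  · exact (measurePreserving_uniformOn_univ _).prod (measurePreserving_uniformOn_univ _)

/-- This invariance replaces explicit computation with the product law: moments are found by
flipping one sign or rotating one bucket. -/
theorem integral_comp_modify {t d w : ℕ} [NeZero w] (i : Fin t) (j : Fin d)
    (e : Fin w ≃ Fin w) (f : Bool ≃ Bool) (F : SketchSeed t d w → ℝ) :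
    ∫ s, F (s.modify i j e f) ∂sketchLaw t d w = ∫ s, F s ∂sketchLaw t d w :=
  (measurePreserving_modify i j e f).hasLaw.integral_comp (AEStronglyMeasurable.of_discrete)

/-- The signed collision indicator of coordinates `j`, `k` in block `i`. -/
noncomputable def collision {t d w : ℕ} (s : SketchSeed t d w) (i : Fin t) (j k : Fin d) : ℝ :=
  if (s i j).1 = (s i k).1 then signOf (s i j).2 * signOf (s i k).2 else 0

theorem signOf_mul_self (b : Bool) : signOf b * signOf b = 1 := by
  cases b <;> simp [signOf]

theorem signOf_not (b : Bool) : signOf (!b) = -signOf b := by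
  cases b <;> simp [signOf]

/-- Flipping the sign of entry `p` negates the first factor, because `p.2 ≠ j`. The second factor
involves only the entries `(q.1, j)` and `q`, both different from `p`, so it is unchanged and the
integral equals its own negative. -/
theorem integral_collision_mul_of_ne {t d w : ℕ} [NeZero w] {j : Fin d} {p q : Fin t × Fin d}
    (hp : p.2 ≠ j) (hpq : p ≠ q) :
    ∫ s, collision s p.1 j p.2 * collision s q.1 j q.2 ∂sketchLaw t d w = 0 := by
  have h := integral_comp_modify (w := w) p.1 p.2 (Equiv.refl _) Equiv.boolNot
    (fun s => collision s p.1 j p.2 * collision s q.1 j q.2)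
  have hflip (s : SketchSeed t d w) :
      collision (s.modify p.1 p.2 (Equiv.refl _) Equiv.boolNot) p.1 j p.2 *
        collision (s.modify p.1 p.2 (Equiv.refl _) Equiv.boolNot) q.1 j q.2 =
      -(collision s p.1 j p.2 * collision s q.1 j q.2) := by
    have hq : ¬ (q.1 = p.1 ∧ q.2 = p.2) := fun h => hpq (Prod.ext h.1.symm h.2.symm)
    simp [collision, SketchSeed.modify, hp.symm, hq, signOf_not]
    split_ifs <;> simp
  simp_rw [hflip, integral_neg] at h
  linarith

/-- The square is the collision indicator. Rotating the bucket of `k` by `a` preserves the law, so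
the `w` events "the buckets differ by `a`" are equally likely, and exactly one of them occurs. -/
theorem integral_collision_sq {t d w : ℕ} [NeZero w] {i : Fin t} {j k : Fin d} (hjk : k ≠ j) :
    ∫ s, collision s i j k * collision s i j k ∂sketchLaw t d w = 1 / w := by
  have hsq (s : SketchSeed t d w) : collision s i j k * collision s i j k =
      if (s i j).1 = (s i k).1 then 1 else 0 := by
    unfold collision
    split_ifs
    · rw [mul_mul_mul_comm, signOf_mul_self, signOf_mul_self, one_mul]
    · simp
  have hinv (a : Fin w) :
      ∫ s, (if (s i j).1 = (s i k).1 + a then 1 else 0 : ℝ) ∂sketchLaw t d w =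
      ∫ s, (if (s i j).1 = (s i k).1 then 1 else 0 : ℝ) ∂sketchLaw t d w := by
    rw [← integral_comp_modify (w := w) i k (Equiv.addRight a) (Equiv.refl _)
      (fun s => if (s i j).1 = (s i k).1 then 1 else 0)]
    simp [SketchSeed.modify, hjk.symm]
  have hsum : ∑ a : Fin w,
      ∫ s, (if (s i j).1 = (s i k).1 + a then 1 else 0 : ℝ) ∂sketchLaw t d w = 1 := by
    rw [← integral_finsetSum _ fun _ _ => Integrable.of_finite]
    have (s : SketchSeed t d w) :
        ∑ a : Fin w, (if (s i j).1 = (s i k).1 + a then 1 else 0 : ℝ) = 1 := by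
      simp_rw [← sub_eq_iff_eq_add']
      simp
    simp [this]
  simp_rw [hinv] at hsum
  simp_rw [hsq]
  have hw : (w : ℝ) ≠ 0 := NeZero.ne _
  rw [Finset.sum_const, Finset.card_univ, Fintype.card_fin, nsmul_eq_mul] at hsum
  field_simp
  linarith

/-- A sum of pairwise orthogonal functions satisfies the Pythagorean identity. -/
theorem integral_sum_sq_of_orthogonal {Ω ι : Type*} [Finite Ω] [MeasurableSpace Ω]
    [MeasurableSingletonClass Ω] {μ : Measure Ω} [IsFiniteMeasure μ] [DecidableEq ι]
    (A : Finset ι) (X : ι → Ω → ℝ) (a : ι → ℝ)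
    (h : ∀ p ∈ A, ∀ q ∈ A, p ≠ q → ∫ s, X p s * X q s ∂μ = 0) :
    ∫ s, (∑ p ∈ A, a p * X p s) ^ 2 ∂μ = ∑ p ∈ A, a p ^ 2 * ∫ s, X p s * X p s ∂μ := by
  simp_rw [sq, Finset.sum_mul_sum]
  rw [integral_finsetSum _ fun _ _ => Integrable.of_finite]
  refine Finset.sum_congr rfl fun p hp => ?_
  rw [integral_finsetSum _ fun _ _ => Integrable.of_finite, Finset.sum_eq_single p]
  · rw [← integral_const_mul]
    congr 1; ext s; ring
  · intro q hq hqp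
    have : ∀ s, a p * X p s * (a q * X q s) = a p * a q * (X p s * X q s) := fun s => by ring
    simp_rw [this]
    rw [integral_const_mul, h p hp q hq hqp.symm, mul_zero]
  · exact fun h => (h hp).elim

/-- The action of `SᵀS - I` in terms of collisions. -/
theorem sketch_gram_sub_apply {t d w : ℕ} [NeZero t] (s : SketchSeed t d w)
    (x : EuclideanSpace ℝ (Fin d)) (j : Fin d) :
    ((sketchMatrix s).transpose.toEuclideanLin ((sketchMatrix s).toEuclideanLin x) - x) j =
      ∑ p ∈ (Finset.univ : Finset (Fin t × Fin d)).filter (fun p => p.2 ≠ j),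
        (x p.2 / t) * collision s p.1 j p.2 := by
  have ht : (t : ℝ) ≠ 0 := NeZero.ne _
  have hs : (1 / Real.sqrt t) * (1 / Real.sqrt t) = 1 / (t : ℝ) := by
    rw [div_mul_div_comm, one_mul, Real.mul_self_sqrt (by positivity)]
  have hentry (k : Fin d) :
      ∑ r, sketchMatrix s r j * sketchMatrix s r k = (1 / t) * ∑ i, collision s i j k := by
    rw [Fintype.sum_prod_type, Finset.mul_sum]
    refine Finset.sum_congr rfl fun i _ => ?_
    have (b : Fin w) : sketchMatrix s (i, b) j * sketchMatrix s (i, b) k =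
        if (s i j).1 = b then (1 / t) * collision s i j k else 0 := by
      simp only [sketchMatrix, Matrix.of_apply, collision]
      rw [mul_mul_mul_comm, hs]
      by_cases h : (s i j).1 = b
      · subst h
        by_cases h' : (s i k).1 = (s i j).1
        · simp [h']
        · simp [h', Ne.symm h']
      · simp [h]
    simp [this]
  -- The diagonal of `SᵀS` is exactly `1`, so subtracting `x` leaves only the terms with `k ≠ j`.
  have hdiag : (1 / t : ℝ) * ∑ i : Fin t, collision s i j j = 1 := by
    simp [collision, signOf_mul_self, ht]
  have hsum : ((sketchMatrix s).transpose.toEuclideanLin ((sketchMatrix s).toEuclideanLin x)) j =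
      ∑ k, x k * ((1 / t) * ∑ i, collision s i j k) := by
    simp only [Matrix.toLpLin_apply, Matrix.mulVec, dotProduct, Matrix.transpose_apply]
    simp_rw [Finset.mul_sum]
    rw [Finset.sum_comm]
    refine Finset.sum_congr rfl fun k _ => ?_
    rw [← Finset.mul_sum, ← Finset.mul_sum, ← hentry k, Finset.mul_sum]
    exact Finset.sum_congr rfl fun r _ => by ring
  rw [PiLp.sub_apply, hsum, ← Finset.add_sum_erase _ _ (Finset.mem_univ j), hdiag, mul_one,
    add_sub_cancel_left, Finset.sum_filter, Fintype.sum_prod_type_right,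
    ← Finset.filter_ne' , Finset.sum_filter]
  refine Finset.sum_congr rfl fun k _ => ?_
  split_ifs
  · rw [Finset.mul_sum, Finset.mul_sum]
    exact Finset.sum_congr rfl fun i _ => by ring
  · simp

/-- The second moment of the error of `SᵀS` as an approximation of the identity. -/
theorem integral_norm_sketch_gram_sub_sq_le {t d w : ℕ} [NeZero t] [NeZero w]
    (x : EuclideanSpace ℝ (Fin d)) :
    ∫ s, ‖(sketchMatrix s).transpose.toEuclideanLin ((sketchMatrix s).toEuclideanLin x) - x‖ ^ 2
      ∂sketchLaw t d w ≤ d * ‖x‖ ^ 2 / ((t * w : ℕ) : ℝ) := by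
  have ht : (t : ℝ) ≠ 0 := NeZero.ne _
  have hw : (w : ℝ) ≠ 0 := NeZero.ne _
  simp_rw [EuclideanSpace.real_norm_sq_eq, sketch_gram_sub_apply]
  rw [integral_finsetSum _ fun _ _ => Integrable.of_finite]
  have hj (j : Fin d) :
      ∫ s, (∑ p ∈ (Finset.univ : Finset (Fin t × Fin d)).filter (fun p => p.2 ≠ j),
        (x p.2 / t) * collision s p.1 j p.2) ^ 2 ∂sketchLaw t d w ≤
      (∑ k, x k ^ 2) / ((t * w : ℕ) : ℝ) := by
    rw [integral_sum_sq_of_orthogonal _ (fun p s => collision s p.1 j p.2) (fun p => x p.2 / t)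
      fun p hp q _ hpq => integral_collision_mul_of_ne (Finset.mem_filter.1 hp).2 hpq]
    calc _ = ∑ p ∈ (Finset.univ : Finset (Fin t × Fin d)).filter (fun p => p.2 ≠ j),
          (x p.2 / t) ^ 2 * (1 / w) :=
          Finset.sum_congr rfl fun p hp => by
            rw [integral_collision_sq (Finset.mem_filter.1 hp).2]
      _ ≤ ∑ p : Fin t × Fin d, (x p.2 / t) ^ 2 * (1 / w) :=
          Finset.sum_le_sum_of_subset_of_nonneg (Finset.filter_subset _ _)
            fun _ _ _ => by positivity
      _ = _ := by
          rw [Fintype.sum_prod_type]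
          dsimp only
          rw [Finset.sum_const, Finset.card_univ, Fintype.card_fin,
            nsmul_eq_mul, Finset.mul_sum, Finset.sum_div]
          refine Finset.sum_congr rfl fun k _ => ?_
          push_cast
          field_simp
  calc _ ≤ ∑ _j : Fin d, (∑ k, x k ^ 2) / ((t * w : ℕ) : ℝ) := Finset.sum_le_sum fun j _ => hj j
    _ = _ := by
      rw [Finset.sum_const, Finset.card_univ, Fintype.card_fin, nsmul_eq_mul, mul_div_assoc]

/-- The columns of the sketch matrix are unit vectors. -/
theorem sum_sketchMatrix_sq {t d w : ℕ} [NeZero t] (s : SketchSeed t d w) (j : Fin d) :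
    ∑ r, sketchMatrix s r j ^ 2 = 1 := by
  have ht : (t : ℝ) ≠ 0 := NeZero.ne _
  have (i : Fin t) (b : Fin w) : sketchMatrix s (i, b) j ^ 2 =
      if (s i j).1 = b then (1 / t : ℝ) else 0 := by
    simp only [sketchMatrix, Matrix.of_apply, mul_pow, div_pow, one_pow]
    rw [Real.sq_sqrt (by positivity)]
    split_ifs <;> simp [sq, signOf_mul_self]
  simp [Fintype.sum_prod_type, this, ht]

/-! ### Clipped messages and privacy -/

/-- There are countably many seeds, and for each of them the output is continuous in the noise. -/
theorem measurable_estimate {n t d w : ℕ} (c σ : ℝ) (D : UserData n d) :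
    Measurable (estimate (t := t) (w := w) c σ D) := by
  refine measurable_from_prod_countable_right fun s => ?_
  have : Continuous (sketchMatrix s).transpose.toEuclideanLin :=
    LinearMap.continuous_of_finiteDimensional _
  exact this.measurable.comp (by fun_prop)

theorem norm_l2clip_le {ι : Type*} [Fintype ι] {r : ℝ} (hr : 0 ≤ r) (y : EuclideanSpace ℝ ι) :
    ‖l2clip r y‖ ≤ r := by
  rw [l2clip, norm_smul, Real.norm_of_nonneg (le_min zero_le_one (by positivity))]
  rcases (norm_nonneg y).eq_or_lt with h | h
  · rw [← h, mul_zero]; exact hr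
  · calc _ ≤ r / ‖y‖ * ‖y‖ := by gcongr; exact min_le_right _ _
      _ = r := div_mul_cancel₀ _ h.ne'

theorem norm_userMessage_le {t d w : ℕ} {c : ℝ} (hc : 0 ≤ c) (s : SketchSeed t d w)
    (o : Option (EuclideanSpace ℝ (Fin d))) : ‖userMessage c s o‖ ≤ 1.1 * c := by
  cases o with
  | none => simpa [userMessage] using by positivity
  | some x => exact norm_l2clip_le (by positivity) _

theorem norm_sum_userMessage_sub_le {n t d w : ℕ} {c : ℝ} (hc : 0 ≤ c) (s : SketchSeed t d w)
    {D D' : UserData n d} (h : UserNeighbor D D') :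
    ‖∑ i, userMessage c s (D i) - ∑ i, userMessage c s (D' i)‖ ≤ 2.2 * c := by
  obtain ⟨i, hi⟩ := h
  rw [← Finset.sum_sub_distrib, Finset.sum_eq_single i]
  · refine (norm_sub_le _ _).trans ?_
    linarith [norm_userMessage_le hc s (D i), norm_userMessage_le hc s (D' i)]
  · intro j _ hj
    rw [hi j hj, sub_self]
  · simp

/-- Privacy of project-and-perturb, under explicit conditions on the noise level. -/
theorem isDP_projectAndPerturb {n d t w : ℕ} (hn : 1 ≤ n) (hw : 1 ≤ w) {c ε δ σ : ℝ}
    (hc : 0 < c) (hε : 0 < ε) (hσ : 0 < σ) (h₁ : (2.2 * c / (n * σ)) ^ 2 ≤ ε)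
    (h₂ : 4 * (2.2 * c / (n * σ)) ^ 2 ≤ δ * ε ^ 2) :
    IsDP (UserNeighbor (n := n) (d := d)) (projectAndPerturb t w c σ) ε δ := by
  have : NeZero w := ⟨by omega⟩
  have hn' : (0 : ℝ) < n := by exact_mod_cast hn
  intro D D' hD A hA
  have hm (D : UserData n d) := measurable_estimate (t := t) (w := w) c σ D
  have key (s : SketchSeed t d w) :
      stdGaussian (EuclideanSpace ℝ (Fin t × Fin w)) (Prod.mk s ⁻¹' (estimate c σ D ⁻¹' A)) ≤
      ENNReal.ofReal (Real.exp ε) *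
        stdGaussian (EuclideanSpace ℝ (Fin t × Fin w)) (Prod.mk s ⁻¹' (estimate c σ D' ⁻¹' A)) +
      ENNReal.ofReal δ := by
    -- The shift in units of `σ`: dataset `D` with noise `g` gives the same output as `D'` with
    -- noise `g + v`.
    set v := (1 / (n * σ)) • (∑ i, userMessage c s (D i) - ∑ i, userMessage c s (D' i)) with hv
    have hvn : ‖v‖ ≤ 2.2 * c / (n * σ) := by
      rw [hv, norm_smul, Real.norm_of_nonneg (by positivity), div_mul_eq_mul_div, one_mul]
      gcongr
      exact norm_sum_userMessage_sub_le hc.le s hD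
    have hv2 : ‖v‖ ^ 2 ≤ (2.2 * c / (n * σ)) ^ 2 := by gcongr
    have hpre : Prod.mk s ⁻¹' (estimate c σ D ⁻¹' A) =
        (· + v) ⁻¹' (Prod.mk s ⁻¹' (estimate c σ D' ⁻¹' A)) := by
      ext g
      have : σ • v = (1 / (n : ℝ)) • ∑ i, userMessage c s (D i) -
          (1 / (n : ℝ)) • ∑ i, userMessage c s (D' i) := by
        rw [hv, smul_smul, ← smul_sub]
        congr 1
        field_simp
      simp only [Set.mem_preimage, estimate, smul_add, this]
      congr! 2
      abel_nf
    rw [hpre]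
    exact stdGaussian_shift_le hε (hv2.trans h₁) (by linarith)
      (measurable_prodMk_left (hm D' hA))
  have hlaw (D : UserData n d) : projectAndPerturb t w c σ D A =
      ∫⁻ s, stdGaussian (EuclideanSpace ℝ (Fin t × Fin w))
        (Prod.mk s ⁻¹' (estimate c σ D ⁻¹' A)) ∂sketchLaw t d w := by
    rw [projectAndPerturb, Measure.map_apply (hm D) hA, Measure.prod_apply (hm D hA)]
  rw [hlaw, hlaw, ← lintegral_const_mul _ Measurable.of_discrete]
  calc _ ≤ _ := lintegral_mono key
    -- The sketch law has total mass `1`, so `δ` is not changed by averaging.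
    _ = _ := by rw [lintegral_add_right _ measurable_const]; simp

/-! ### Utility: clipping bias and back-projected noise -/

/-- Deterministic control of the reconstruction error of one clipped message: clipping is active
only if the sketch distorts the vector substantially. -/
theorem norm_transpose_l2clip_sub_le {t d w : ℕ} (s : SketchSeed t d w) {c : ℝ} (hc : 0 < c)
    {x : EuclideanSpace ℝ (Fin d)} (hx : ‖x‖ ≤ c) :
    ‖(sketchMatrix s).transpose.toEuclideanLin
        (l2clip (1.1 * c) ((sketchMatrix s).toEuclideanLin x)) - x‖ ≤
      7 * ‖(sketchMatrix s).transpose.toEuclideanLin ((sketchMatrix s).toEuclideanLin x) - x‖ := by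
  set y := (sketchMatrix s).toEuclideanLin x with hy
  set z := (sketchMatrix s).transpose.toEuclideanLin y
  set l := min 1 (1.1 * c / ‖y‖) with hl
  have hl1 : l ≤ 1 := min_le_left _ _
  have hl0 : 0 ≤ l := le_min zero_le_one (by positivity)
  have hclip : (sketchMatrix s).transpose.toEuclideanLin (l2clip (1.1 * c) y) = l • z := by
    rw [l2clip, map_smul]
  rw [hclip]
  have hsplit : l • z - x = l • (z - x) - (1 - l) • x := by module
  have hbound : ‖l • z - x‖ ≤ ‖z - x‖ + (1 - l) * ‖x‖ := by
    rw [hsplit]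
    refine (norm_sub_le _ _).trans ?_
    rw [norm_smul, norm_smul, Real.norm_of_nonneg hl0, Real.norm_of_nonneg (sub_nonneg.2 hl1)]
    gcongr
    exact mul_le_of_le_one_left (norm_nonneg _) hl1
  have hz := norm_nonneg (z - x)
  by_cases hcase : ‖y‖ ≤ 1.1 * c
  · have : l • z = z := by
      -- At `y = 0` the convention `r / 0 = 0` makes `l = 0`, which is harmless since `z = 0`.
      rcases eq_or_ne y 0 with h | h
      · simp [z, h]
      · have : l = 1 := min_eq_left ((one_le_div (norm_pos_iff.2 h)).2 hcase)
        rw [this, one_smul]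
    rw [this]
    linarith
  · push Not at hcase
    have hinner : inner ℝ x z = ‖y‖ ^ 2 := by
      rw [← real_inner_self_eq_norm_sq y]
      have h := LinearMap.adjoint_inner_right (sketchMatrix s).toEuclideanLin x y
      rw [← Matrix.toEuclideanLin_conjTranspose_eq_adjoint, ← hy] at h
      simpa using h
    have hcs : ‖y‖ ^ 2 - ‖x‖ ^ 2 ≤ ‖x‖ * ‖z - x‖ := by
      rw [← hinner, ← real_inner_self_eq_norm_sq x, ← inner_sub_right]
      exact real_inner_le_norm _ _
    have hxz : ‖x‖ * ‖z - x‖ ≤ c * ‖z - x‖ := by gcongr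
    have hx2 : ‖x‖ ^ 2 ≤ c ^ 2 := by gcongr
    have hy2 : (1.1 * c) ^ 2 ≤ ‖y‖ ^ 2 := by gcongr
    -- `0.21 = 1.1² - 1`. The error is then at most `‖z - x‖ + c ≤ (1 + 1 / 0.21) ‖z - x‖`, and `1 +
    -- 1 / 0.21 < 7`.
    have hc' : 0.21 * c ≤ ‖z - x‖ := by
      refine le_of_mul_le_mul_left ?_ hc
      nlinarith
    have : (1 - l) * ‖x‖ ≤ ‖x‖ := mul_le_of_le_one_left (norm_nonneg _) (by linarith)
    linarith

/-- Second moment of the back-projected Gaussian noise. -/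
theorem lintegral_norm_transpose_sq {t d w : ℕ} [NeZero t] (s : SketchSeed t d w) :
    ∫⁻ g, ENNReal.ofReal (‖(sketchMatrix s).transpose.toEuclideanLin g‖ ^ 2)
      ∂stdGaussian (EuclideanSpace ℝ (Fin t × Fin w)) = ENNReal.ofReal d := by
  have hcol (j : Fin d) (g : EuclideanSpace ℝ (Fin t × Fin w)) :
      ((sketchMatrix s).transpose.toEuclideanLin g) j =
        inner ℝ (WithLp.toLp 2 fun r => sketchMatrix s r j) g := by
    simp [Matrix.toLpLin_apply, Matrix.mulVec, dotProduct, PiLp.inner_apply, mul_comm]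
  simp_rw [EuclideanSpace.real_norm_sq_eq, hcol,
    ENNReal.ofReal_sum_of_nonneg (fun _ _ => sq_nonneg _)]
  rw [lintegral_finsetSum _ fun _ _ => by fun_prop]
  simp_rw [lintegral_inner_sq_stdGaussian, EuclideanSpace.real_norm_sq_eq, sum_sketchMatrix_sq]
  simp

/-- A bound on the lower integral yields integrability and the numerical bound at once. -/
theorem mseAtMost_of_lintegral_le {d : ℕ} {P : Measure (EuclideanSpace ℝ (Fin d))}
    {μ : EuclideanSpace ℝ (Fin d)} {B : ℝ} (hB : 0 ≤ B)
    (h : ∫⁻ z, ENNReal.ofReal (‖z - μ‖ ^ 2) ∂P ≤ ENNReal.ofReal B) : MSEAtMost P μ B := by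
  have hnn : 0 ≤ᵐ[P] fun z => ‖z - μ‖ ^ 2 := ae_of_all _ fun _ => by positivity
  have hmeas : AEStronglyMeasurable (fun z => ‖z - μ‖ ^ 2) P := by fun_prop
  refine ⟨⟨hmeas, ?_⟩, ?_⟩
  · rw [hasFiniteIntegral_iff_ofReal hnn]
    exact h.trans_lt ENNReal.ofReal_lt_top
  · rw [integral_eq_lintegral_of_nonneg_ae hnn hmeas]
    exact ENNReal.toReal_le_of_le_ofReal hB h

/-- Convexity of the squared norm: the error of the average is at most the average of the users'
errors, with no independence between users. -/
theorem norm_smul_sum_sq_le {ι E : Type*} [Fintype ι] [NormedAddCommGroup E] [NormedSpace ℝ E]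
    (f : ι → E) :
    ‖(1 / (Fintype.card ι : ℝ)) • ∑ i, f i‖ ^ 2 ≤ (1 / (Fintype.card ι : ℝ)) * ∑ i, ‖f i‖ ^ 2 := by
  rcases isEmpty_or_nonempty ι with h | h
  · simp
  have hN : (0 : ℝ) < Fintype.card ι := by exact_mod_cast Fintype.card_pos
  rw [norm_smul, mul_pow, Real.norm_of_nonneg (by positivity)]
  have h1 : ‖∑ i, f i‖ ^ 2 ≤ Fintype.card ι * ∑ i, ‖f i‖ ^ 2 := by
    refine (pow_le_pow_left₀ (norm_nonneg _) (norm_sum_le _ _) 2).trans ?_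
    simpa using sq_sum_le_card_mul_sum_sq (s := Finset.univ) (f := fun i => ‖f i‖)
  calc _ ≤ (1 / (Fintype.card ι : ℝ)) ^ 2 * (Fintype.card ι * ∑ i, ‖f i‖ ^ 2) := by gcongr
    _ = _ := by field_simp

/-- Utility of project-and-perturb, with explicit constants. -/
theorem mseAtMost_projectAndPerturb {n d t w : ℕ} (hn : 1 ≤ n) (ht : 1 ≤ t) (hw : 1 ≤ w)
    {c σ : ℝ} (hc : 0 < c) {x : Fin n → EuclideanSpace ℝ (Fin d)} (hx : ∀ i, ‖x i‖ ≤ c) :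
    MSEAtMost (projectAndPerturb t w c σ fun i => some (x i)) (sampleMean x)
      (98 * (d * c ^ 2 / ((t * w : ℕ) : ℝ)) + 2 * σ ^ 2 * d) := by
  have : NeZero w := ⟨by omega⟩
  have : NeZero t := ⟨by omega⟩
  have hn' : (0 : ℝ) < n := by exact_mod_cast hn
  set e : Fin n → SketchSeed t d w → ℝ := fun i s =>
    ‖(sketchMatrix s).transpose.toEuclideanLin ((sketchMatrix s).toEuclideanLin (x i)) - x i‖
  -- `98 = 2 * 7²`: the `7` is the cost of clipping, the `2` comes from `(a + b)² ≤ 2 (a² + b²)`,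
  -- which separates bias and noise.
  set B : SketchSeed t d w → ℝ := fun s => 98 * ((1 / n) * ∑ i, e i s ^ 2) with hBdef
  have hB0 (s) : 0 ≤ B s := by positivity
  have hpt (s : SketchSeed t d w) (g : EuclideanSpace ℝ (Fin t × Fin w)) :
      ‖estimate c σ (fun i => some (x i)) (s, g) - sampleMean x‖ ^ 2 ≤
        B s + 2 * σ ^ 2 * ‖(sketchMatrix s).transpose.toEuclideanLin g‖ ^ 2 := by
    have hsplit : estimate c σ (fun i => some (x i)) (s, g) - sampleMean x =
        (1 / (n : ℝ)) • ∑ i, ((sketchMatrix s).transpose.toEuclideanLin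
          (l2clip (1.1 * c) ((sketchMatrix s).toEuclideanLin (x i))) - x i) +
        σ • (sketchMatrix s).transpose.toEuclideanLin g := by
      simp only [estimate, sampleMean, userMessage, map_add, map_smul, map_sum,
        Finset.sum_sub_distrib, smul_sub]
      abel
    rw [hsplit]
    have hbias : ‖(1 / (n : ℝ)) • ∑ i, ((sketchMatrix s).transpose.toEuclideanLin
          (l2clip (1.1 * c) ((sketchMatrix s).toEuclideanLin (x i))) - x i)‖ ^ 2 ≤
        (1 / n) * ∑ i, (7 * e i s) ^ 2 := by
      have h := norm_smul_sum_sq_le fun i => (sketchMatrix s).transpose.toEuclideanLin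
          (l2clip (1.1 * c) ((sketchMatrix s).toEuclideanLin (x i))) - x i
      rw [Fintype.card_fin] at h
      refine h.trans ?_
      gcongr with i
      exact norm_transpose_l2clip_sub_le s hc (hx i)
    refine (pow_le_pow_left₀ (norm_nonneg _) (norm_add_le _ _) 2).trans (add_sq_le.trans ?_)
    rw [norm_smul σ, mul_pow ‖σ‖, Real.norm_eq_abs, sq_abs]
    simp_rw [mul_pow, ← Finset.mul_sum] at hbias
    simp only [hBdef]
    nlinarith
  have hBint : ∫ s, B s ∂sketchLaw t d w ≤ 98 * (d * c ^ 2 / ((t * w : ℕ) : ℝ)) := by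
    simp only [hBdef]
    rw [integral_const_mul, integral_const_mul,
      integral_finsetSum _ fun _ _ => Integrable.of_finite]
    have : ∑ i, ∫ s, e i s ^ 2 ∂sketchLaw t d w ≤ n * (d * c ^ 2 / ((t * w : ℕ) : ℝ)) := by
      calc _ ≤ ∑ _i : Fin n, (d * c ^ 2 / ((t * w : ℕ) : ℝ)) := by
            refine Finset.sum_le_sum fun i _ =>
              (integral_norm_sketch_gram_sub_sq_le (x i)).trans ?_
            gcongr
            exact hx i
        _ = _ := by simp
    calc _ ≤ 98 * ((1 / (n : ℝ)) * (n * (d * c ^ 2 / ((t * w : ℕ) : ℝ)))) := by gcongr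
      _ = _ := by field_simp
  refine mseAtMost_of_lintegral_le (by positivity) ?_
  have hm := measurable_estimate (t := t) (w := w) c σ (fun i => some (x i))
  rw [projectAndPerturb, lintegral_map (by fun_prop) hm,
    lintegral_prod _ (Measurable.aemeasurable (by fun_prop))]
  have hinner (s : SketchSeed t d w) :
      ∫⁻ g, ENNReal.ofReal (‖estimate c σ (fun i => some (x i)) (s, g) - sampleMean x‖ ^ 2)
        ∂stdGaussian (EuclideanSpace ℝ (Fin t × Fin w)) ≤
      ENNReal.ofReal (B s) + ENNReal.ofReal (2 * σ ^ 2 * d) := by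
    calc _ ≤ ∫⁻ g, (ENNReal.ofReal (B s) + ENNReal.ofReal (2 * σ ^ 2) *
          ENNReal.ofReal (‖(sketchMatrix s).transpose.toEuclideanLin g‖ ^ 2))
          ∂stdGaussian (EuclideanSpace ℝ (Fin t × Fin w)) := by
          refine lintegral_mono fun g => ?_
          rw [← ENNReal.ofReal_mul (by positivity), ← ENNReal.ofReal_add (hB0 s) (by positivity)]
          exact ENNReal.ofReal_le_ofReal (hpt s g)
      _ = _ := by
          rw [lintegral_add_left measurable_const,
            lintegral_const_mul' _ _ ENNReal.ofReal_ne_top,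
            lintegral_norm_transpose_sq, ← ENNReal.ofReal_mul (by positivity)]
          simp
  calc _ ≤ ∫⁻ s, (ENNReal.ofReal (B s) + ENNReal.ofReal (2 * σ ^ 2 * d)) ∂sketchLaw t d w :=
        lintegral_mono hinner
    _ = ENNReal.ofReal (∫ s, B s ∂sketchLaw t d w) + ENNReal.ofReal (2 * σ ^ 2 * d) := by
        rw [lintegral_add_left Measurable.of_discrete,
          ofReal_integral_eq_lintegral_ofReal Integrable.of_finite (ae_of_all _ hB0)]
        simp
    _ ≤ _ := by
        rw [← ENNReal.ofReal_add (integral_nonneg hB0) (by positivity)]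
        exact ENNReal.ofReal_le_ofReal (by linarith)

/-! ### Choice of the parameters -/

/-- Sketch dimensions for a target size `q` and a target number of blocks of order `l`. -/
theorem exists_sketch_dimensions {q l : ℝ} (hl : 1 / 2 ≤ l) (hlq : l ≤ 2 * q) (hq : 1 ≤ q) :
    ∃ t w : ℕ, 1 ≤ t ∧ 1 ≤ w ∧ Between 1 4 q ((t * w : ℕ) : ℝ) ∧ Between 1 3 l (t : ℝ) := by
  have ht : 1 ≤ ⌈l⌉₊ := Nat.one_le_ceil_iff.2 (by linarith)
  have ht' : (0 : ℝ) < ⌈l⌉₊ := by exact_mod_cast ht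
  have hlt : (⌈l⌉₊ : ℝ) < l + 1 := Nat.ceil_lt_add_one (by linarith)
  have hle : l ≤ ⌈l⌉₊ := Nat.le_ceil l
  -- With `t = ⌈l⌉` and `w = ⌈q / t⌉`, rounding gives `q ≤ t w ≤ q + t ≤ q + l + 1 ≤ 4 q`, and `t ≤
  -- l + 1 ≤ 3 l` because `l ≥ 1 / 2`.
  refine ⟨⌈l⌉₊, ⌈q / ⌈l⌉₊⌉₊, ht, Nat.one_le_ceil_iff.2 (by positivity), ⟨?_, ?_⟩, ?_, ?_⟩
  · have := mul_le_mul_of_nonneg_left (Nat.le_ceil (q / ⌈l⌉₊)) ht'.le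
    rw [mul_div_cancel₀ _ ht'.ne'] at this
    push_cast
    linarith
  · have := mul_le_mul_of_nonneg_left
      (Nat.ceil_lt_add_one (a := q / ⌈l⌉₊) (by positivity)).le ht'.le
    rw [mul_add, mul_div_cancel₀ _ ht'.ne'] at this
    push_cast
    linarith
  · linarith
  · linarith

theorem exists_noise_isDP {δ ε₀ : ℝ} (hδ : 0 < δ) (hε₀ : 0 < ε₀) :
    ∃ κ : ℝ, 0 < κ ∧ ∀ n d t w : ℕ, 1 ≤ n → 1 ≤ w →
      ∀ c ε σ : ℝ, 0 < c → 0 < ε → ε ≤ ε₀ → 0 ≤ σ →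
        κ * (c ^ 2 / ((n : ℝ) ^ 2 * ε ^ 2)) ≤ σ ^ 2 →
        IsDP (UserNeighbor (n := n) (d := d)) (projectAndPerturb t w c σ) ε δ := by
  -- Let `u = 2.2 c / (n σ)`. The hypothesis becomes `u² (ε₀ + 4 / δ) ≤ ε²`. The first summand gives
  -- `u² ε₀ ≤ ε² ≤ ε ε₀`, hence `u² ≤ ε`; the second gives `4 u² ≤ δ ε²`.
  refine ⟨2.2 ^ 2 * (ε₀ + 4 / δ), by positivity, ?_⟩
  intro n d t w hn hw c ε σ hc hε hεε₀ hσ hκ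
  have hn' : (0 : ℝ) < n := by exact_mod_cast hn
  have hσ2 : 0 < σ ^ 2 := lt_of_lt_of_le (by positivity) hκ
  have hσ' : 0 < σ := hσ.lt_of_ne' (pow_ne_zero_iff two_ne_zero |>.1 hσ2.ne')
  have hsq : (2.2 * c / (n * σ)) ^ 2 * (ε₀ + 4 / δ) ≤ ε ^ 2 := by
    rw [mul_div_assoc', div_le_iff₀ (by positivity)] at hκ
    rw [div_pow, div_mul_eq_mul_div, div_le_iff₀ (by positivity)]
    linarith
  have ha := sq_nonneg (2.2 * c / (n * σ))
  have h4 : 0 < 4 / δ := by positivity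
  refine isDP_projectAndPerturb hn hw hc hε hσ' ?_ ?_
  · have : (2.2 * c / (n * σ)) ^ 2 * ε₀ ≤ ε * ε₀ := by nlinarith
    exact le_of_mul_le_mul_right this hε₀
  · have : (2.2 * c / (n * σ)) ^ 2 * (4 / δ) ≤ ε ^ 2 := by nlinarith
    rw [mul_div_assoc', div_le_iff₀ hδ] at this
    linarith

theorem mseAtMost_of_noise_le {κ a : ℝ} (ha : 0 < a) {n d t w : ℕ} (hn : 1 ≤ n) (ht : 1 ≤ t)
    (hw : 1 ≤ w) {c ε σ : ℝ} (hc : 0 < c) (hε : 0 < ε)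
    (hσ : σ ^ 2 ≤ κ * (c ^ 2 / ((n : ℝ) ^ 2 * ε ^ 2)))
    (hm : a * ((n : ℝ) ^ 2 * ε ^ 2) ≤ ((t * w : ℕ) : ℝ))
    {x : Fin n → EuclideanSpace ℝ (Fin d)} (hx : ∀ i, ‖x i‖ ≤ c) :
    MSEAtMost (projectAndPerturb t w c σ fun i => some (x i)) (sampleMean x)
      ((98 / a + 2 * κ) * (c ^ 2 * d / ((n : ℝ) ^ 2 * ε ^ 2))) := by
  have hn' : (0 : ℝ) < n := by exact_mod_cast hn
  obtain ⟨hint, hle⟩ := mseAtMost_projectAndPerturb (σ := σ) hn ht hw hc hx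
  refine ⟨hint, hle.trans ?_⟩
  have h1 : d * c ^ 2 / ((t * w : ℕ) : ℝ) ≤ d * c ^ 2 / (a * ((n : ℝ) ^ 2 * ε ^ 2)) := by gcongr
  have h2 : σ ^ 2 * d ≤ κ * (c ^ 2 / ((n : ℝ) ^ 2 * ε ^ 2)) * d := by gcongr
  calc _ ≤ 98 * (d * c ^ 2 / (a * ((n : ℝ) ^ 2 * ε ^ 2))) +
        2 * (κ * (c ^ 2 / ((n : ℝ) ^ 2 * ε ^ 2)) * d) := by linarith
    _ = _ := by field_simp

theorem mainTheorem5 :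
    -- privacy: the noise constant depends on `δ` and on an upper bound for `ε` only
    (∀ δ : ℝ, 0 < δ → ∀ ε₀ : ℝ, 0 < ε₀ → ∃ κ : ℝ, 0 < κ ∧
      ∀ n d t w : ℕ, 1 ≤ n → 1 ≤ d → 1 ≤ t → 1 ≤ w →
      ∀ c ε σ : ℝ, 0 < c → 0 < ε → ε ≤ ε₀ → 0 ≤ σ →
        κ * (c ^ 2 / ((n : ℝ) ^ 2 * ε ^ 2)) ≤ σ ^ 2 →
        IsDP (UserNeighbor (n := n) (d := d)) (projectAndPerturb t w c σ) ε δ) ∧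
    -- utility: for all choices of the constants behind the `Θ`s
    (∀ κ₁ κ₂ a₁ a₂ b₁ b₂ : ℝ, 0 < κ₁ → 0 < κ₂ → 0 < a₁ → 0 < a₂ → 0 < b₁ → 0 < b₂ →
      ∃ C : ℝ, 0 < C ∧
      ∀ n d t w : ℕ, 1 ≤ n → 1 ≤ d → 1 ≤ t → 1 ≤ w →
      ∀ c ε σ : ℝ, 0 < c → 0 < ε → 0 ≤ σ →
        Between κ₁ κ₂ (c ^ 2 / ((n : ℝ) ^ 2 * ε ^ 2)) (σ ^ 2) →
        Between a₁ a₂ ((n : ℝ) ^ 2 * ε ^ 2) ((t * w : ℕ) : ℝ) →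
        Between b₁ b₂ (Real.log d + Real.log ((n : ℝ) ^ 2 * ε ^ 2)) (t : ℝ) →
        ∀ x : Fin n → EuclideanSpace ℝ (Fin d), (∀ i, ‖x i‖ ≤ c) →
          MSEAtMost (projectAndPerturb t w c σ fun i => some (x i)) (sampleMean x)
            (C * (c ^ 2 * d / ((n : ℝ) ^ 2 * ε ^ 2)))) ∧
    -- both together: suitable `m = t * w` and `t` exist as soon as `m` can be at least `t`
    (∃ a₁ a₂ b₁ b₂ : ℝ, 0 < a₁ ∧ 0 < a₂ ∧ 0 < b₁ ∧ 0 < b₂ ∧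
      ∀ δ : ℝ, 0 < δ → ∀ ε₀ : ℝ, 0 < ε₀ → ∃ κ C : ℝ, 0 < κ ∧ 0 < C ∧
      ∀ n d : ℕ, 1 ≤ n → 2 ≤ d →
      ∀ c ε : ℝ, 0 < c → 0 < ε → ε ≤ ε₀ →
        1 ≤ (n : ℝ) ^ 2 * ε ^ 2 → Real.log d ≤ (n : ℝ) ^ 2 * ε ^ 2 →
        ∃ t w : ℕ, ∃ σ : ℝ, 1 ≤ t ∧ 1 ≤ w ∧ 0 ≤ σ ∧
          σ ^ 2 = κ * (c ^ 2 / ((n : ℝ) ^ 2 * ε ^ 2)) ∧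
          Between a₁ a₂ ((n : ℝ) ^ 2 * ε ^ 2) ((t * w : ℕ) : ℝ) ∧
          Between b₁ b₂ (Real.log d + Real.log ((n : ℝ) ^ 2 * ε ^ 2)) (t : ℝ) ∧
          IsDP (UserNeighbor (n := n) (d := d)) (projectAndPerturb t w c σ) ε δ ∧
          ∀ x : Fin n → EuclideanSpace ℝ (Fin d), (∀ i, ‖x i‖ ≤ c) →
            MSEAtMost (projectAndPerturb t w c σ fun i => some (x i)) (sampleMean x)
              (C * (c ^ 2 * d / ((n : ℝ) ^ 2 * ε ^ 2)))) := by

  refine ⟨fun δ hδ ε₀ hε₀ => ?_, fun κ₁ κ₂ a₁ a₂ b₁ b₂ _ hκ₂ ha₁ _ _ _ => ?_,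
    1, 4, 1, 3, by norm_num, by norm_num, by norm_num, by norm_num, fun δ hδ ε₀ hε₀ => ?_⟩
  · obtain ⟨κ, hκ, h⟩ := exists_noise_isDP hδ hε₀
    exact ⟨κ, hκ, fun n d t w hn _ _ hw => h n d t w hn hw⟩
  · exact ⟨98 / a₁ + 2 * κ₂, by positivity,
      fun n d t w hn _ ht hw c ε σ hc hε _ hσ hm _ x hx =>
        mseAtMost_of_noise_le ha₁ hn ht hw hc hε hσ.2 hm.1 hx⟩
  · obtain ⟨κ, hκ, h⟩ := exists_noise_isDP hδ hε₀
    refine ⟨κ, 98 / 1 + 2 * κ, hκ, by positivity, fun n d hn hd c ε hc hε hεε₀ hq hlog => ?_⟩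
    -- With `q = n² ε²` and `l = log d + log q`: `l ≥ log 2 > 1 / 2` because `d ≥ 2` and `q ≥ 1`,
    -- while `log d ≤ q` and `log q ≤ q` give `l ≤ 2 q`.
    have hlogd : 1 / 2 ≤ Real.log d := by
      have h2 : Real.log 2 ≤ Real.log d := Real.log_le_log two_pos (by exact_mod_cast hd)
      linarith [Real.log_two_gt_d9]
    have hlogq := Real.log_nonneg hq
    have hlogq' := Real.log_le_self (zero_le_one.trans hq)
    obtain ⟨t, w, ht, hw, hm, hb⟩ := exists_sketch_dimensions
      (l := Real.log d + Real.log ((n : ℝ) ^ 2 * ε ^ 2)) (by linarith) (by linarith) hq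
    have hσ := Real.sq_sqrt (show 0 ≤ κ * (c ^ 2 / ((n : ℝ) ^ 2 * ε ^ 2)) by positivity)
    exact ⟨t, w, _, ht, hw, Real.sqrt_nonneg _, hσ, hm, hb,
      h n d t w hn hw c ε _ hc hε hεε₀ (Real.sqrt_nonneg _) hσ.ge,
      fun x hx => mseAtMost_of_noise_le one_pos hn ht hw hc hε hσ.le hm.1 hx⟩
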